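/- Let $I=(c,d)$ with $-\infty\le c<d\le\infty$, let $p\in(1,\infty)$, $p'=\frac{p}{p-1}$, and $\nu\in\{1,2\}$. For $x\in I$ put $I_{1,x}=I_{2,x}^*=(c,x]$ and $I_{2,x}=I_{1,x}^*=[x,d)$. Let $w$ be a Lebesgue measurable function on $I$ with $w>0$ almost everywhere on $I$ and $\int_{I_{\nu,x}^*}w^p<\infty$ for every $x\in I$. Let $Ch_{p,w}(I)$ be the space of all measurable functions $f$ on $I$ (identified when they are equal almost everywhere) such that $\int_{I_{\nu,x}}|f|<\infty$ for every $x\in I$ and $$\|f\|_{Ch_{p,w}(I)}:=\left(\int_I\left|w(x)\int_{I_{\nu,x}}f\right|^p\,dx\right)^{1/p}<\infty .$$ Let $L^{p'}_{1/w}(I)$ be the space of all measurable functions $h$ on $I$ with $\|h\|_{L^{p'}_{1/w}(I)}:=\left(\int_I\left|\frac{h(x)}{w(x)}\right|^{p'}dx\right)^{1/p'}<\infty$. Theorem. For every continuous linear functional $\Lambda\in (Ch_{p,w}(I))^*$ there exists $h\in L^{p'}_{1/w}(I)$ such that $$\Lambda f=\int_I h(x)\left[\int_{I_{\nu,x}}f\right]dx\qquad\text{for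 all } f\in Ch_{p,w}(I)$$ (the integral over $I$ being absolutely convergent), and $\|\Lambda\|_{(Ch_{p,w}(I))^*}=\|h\|_{L^{p'}_{1/w}(I)}$. -/

import Mathlib

open MeasureTheory

noncomputable section

namespace AlteredCesaro

/-- The open interval `I = (c, d) ⊆ ℝ`, bounded or not. -/
def interval (c d : EReal) : Set ℝ := {x : ℝ | c < (x : EReal) ∧ (x : EReal) < d}

/-- Lebesgue measure on `I = (c, d)`. -/
def leb (c d : EReal) : Measure ℝ := volume.restrict (interval c d)

/-- `I_{ν,x}`: it is `(c, x]` for `ν = 1` and `[x, d)` for `ν = 2`. -/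
def part (c d : EReal) (ν : ℕ) (x : ℝ) : Set ℝ :=
  if ν = 1 then {y : ℝ | c < (y : EReal) ∧ y ≤ x} else {y : ℝ | x ≤ y ∧ (y : EReal) < d}

/-- `I*_{ν,x}`: it is `[x, d)` for `ν = 1` and `(c, x]` for `ν = 2`. -/
def partStar (c d : EReal) (ν : ℕ) (x : ℝ) : Set ℝ :=
  if ν = 1 then {y : ℝ | x ≤ y ∧ (y : EReal) < d} else {y : ℝ | c < (y : EReal) ∧ y ≤ x}

/-- `f ∈ L¹_{loc,(ν,1)}`: `f` is integrable over `I_{ν,x}` for every `x ∈ I`. -/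
def MemLocOne (c d : EReal) (ν : ℕ) (f : ℝ → ℝ) : Prop :=
  ∀ x ∈ interval c d, IntegrableOn f (part c d ν x) (leb c d)

/-- `f ∈ L¹_{loc,(ν,2)}`: `f` is integrable over `I*_{ν,x}` for every `x ∈ I`. -/
def MemLocTwo (c d : EReal) (ν : ℕ) (f : ℝ → ℝ) : Prop :=
  ∀ x ∈ interval c d, IntegrableOn f (partStar c d ν x) (leb c d)

/-- The function `x ↦ ∫_{I_{ν,x}} f`. -/
def primitive (c d : EReal) (ν : ℕ) (f : ℝ → ℝ) (x : ℝ) : ℝ :=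
  ∫ y in part c d ν x, f y ∂(leb c d)

/-- `h ∈ L^q_v(I)`: `h` is measurable on `I` and `v h ∈ L^q(I)`. -/
def MemWeightedLp (c d : EReal) (q : ℝ) (v h : ℝ → ℝ) : Prop :=
  AEStronglyMeasurable h (leb c d) ∧ MemLp (fun x => v x * h x) (ENNReal.ofReal q) (leb c d)

/-- `‖h‖_{L^q_v(I)} = ‖v h‖_{L^q(I)}`. -/
def weightedLpNorm (c d : EReal) (q : ℝ) (v h : ℝ → ℝ) : ℝ :=
  (eLpNorm (fun x => v x * h x) (ENNReal.ofReal q) (leb c d)).toReal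

theorem primitive_add {c d : EReal} {ν : ℕ} {f g k : ℝ → ℝ} (hf : MemLocOne c d ν f)
    (hg : MemLocOne c d ν g) (hk : k =ᵐ[leb c d] f + g) {x : ℝ} (hx : x ∈ interval c d) :
    primitive c d ν k x = primitive c d ν f x + primitive c d ν g x := by
  unfold primitive
  rw [← integral_add (hf x hx) (hg x hx)]
  exact integral_congr_ae (ae_restrict_of_ae hk)

theorem primitive_smul {c d : EReal} {ν : ℕ} (a : ℝ) {f k : ℝ → ℝ}
    (hk : k =ᵐ[leb c d] a • f) (x : ℝ) :
    primitive c d ν k x = a * primitive c d ν f x := by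
  unfold primitive
  rw [← integral_const_mul]
  exact integral_congr_ae (ae_restrict_of_ae hk)

theorem measurableSet_interval (c d : EReal) : MeasurableSet (interval c d) :=
  (measurableSet_lt measurable_const measurable_coe_real_ereal).inter
    (measurableSet_lt measurable_coe_real_ereal measurable_const)

theorem ae_mem_interval (c d : EReal) : ∀ᵐ x ∂(leb c d), x ∈ interval c d :=
  ae_restrict_mem (measurableSet_interval c d)

theorem MemLocOne.congr {c d : EReal} {ν : ℕ} {f k : ℝ → ℝ} (hf : MemLocOne c d ν f)
    (hk : k =ᵐ[leb c d] f) : MemLocOne c d ν k :=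
  fun x hx => (hf x hx).congr_fun_ae (ae_restrict_of_ae hk.symm)

theorem weighted_add {c d : EReal} {ν : ℕ} (w : ℝ → ℝ) {f g k : ℝ → ℝ} (hf : MemLocOne c d ν f)
    (hg : MemLocOne c d ν g) (hk : k =ᵐ[leb c d] f + g) :
    (fun x => w x * primitive c d ν k x) =ᵐ[leb c d]
      (fun x => w x * primitive c d ν f x) + (fun x => w x * primitive c d ν g x) := by
  filter_upwards [ae_mem_interval c d] with x hx
  simp only [Pi.add_apply, primitive_add hf hg hk hx, mul_add]

theorem weighted_smul {c d : EReal} {ν : ℕ} (w : ℝ → ℝ) (a : ℝ) {f k : ℝ → ℝ}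
    (hk : k =ᵐ[leb c d] a • f) :
    (fun x => w x * primitive c d ν k x) = a • (fun x => w x * primitive c d ν f x) := by
  funext x
  simp only [Pi.smul_apply, smul_eq_mul, primitive_smul a hk]
  ring

/-- The altered Cesàro–Copson space `Ch_{p,w}(I)`: the (classes modulo equality almost everywhere
on `I` of) measurable functions `f ∈ L¹_{loc,(ν,1)}` for which `x ↦ w(x) ∫_{I_{ν,x}} f` is
in `L^p(I)`. -/
def Ch (c d : EReal) (p : ℝ) (ν : ℕ) (w : ℝ → ℝ) : Submodule ℝ (ℝ →ₘ[leb c d] ℝ) where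
  carrier := {f | MemLocOne c d ν f ∧
    MemLp (fun x => w x * primitive c d ν f x) (ENNReal.ofReal p) (leb c d)}
  zero_mem' := by
    have h0 : ((0 : ℝ →ₘ[leb c d] ℝ) : ℝ → ℝ) =ᵐ[leb c d] (0 : ℝ) • (0 : ℝ → ℝ) := by
      rw [smul_zero]; exact AEEqFun.coeFn_zero
    refine ⟨?_, ?_⟩
    · exact MemLocOne.congr (f := (0 : ℝ → ℝ)) (fun x _ => integrableOn_zero)
        AEEqFun.coeFn_zero
    · rw [weighted_smul w 0 h0, zero_smul]
      exact MemLp.zero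
  add_mem' := by
    rintro f g ⟨hf, hf'⟩ ⟨hg, hg'⟩
    refine ⟨MemLocOne.congr (fun x hx => (hf x hx).add (hg x hx)) (AEEqFun.coeFn_add f g), ?_⟩
    exact (memLp_congr_ae (weighted_add w hf hg (AEEqFun.coeFn_add f g))).2 (hf'.add hg')
  smul_mem' := by
    rintro a f ⟨hf, hf'⟩
    refine ⟨MemLocOne.congr (fun x hx => (hf x hx).smul a) (AEEqFun.coeFn_smul a f), ?_⟩
    rw [weighted_smul w a (AEEqFun.coeFn_smul a f)]
    exact hf'.const_smul a

/-- `‖f‖_{Ch_{p,w}(I)} = (∫_I |w(x) ∫_{I_{ν,x}} f|^p dx)^{1/p}`. -/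
def chNorm (c d : EReal) (p : ℝ) (ν : ℕ) (w f : ℝ → ℝ) : ℝ :=
  (eLpNorm (fun x => w x * primitive c d ν f x) (ENNReal.ofReal p) (leb c d)).toReal

theorem chNorm_smul {c d : EReal} {p : ℝ} {ν : ℕ} {w : ℝ → ℝ} (a : ℝ) (f : Ch c d p ν w) :
    chNorm c d p ν w ((a • f : Ch c d p ν w) : ℝ →ₘ[leb c d] ℝ)
      = |a| * chNorm c d p ν w (f : ℝ →ₘ[leb c d] ℝ) := by
  unfold chNorm
  rw [Submodule.coe_smul, weighted_smul w a (AEEqFun.coeFn_smul a _), eLpNorm_const_smul,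
    ENNReal.toReal_mul, toReal_enorm, Real.norm_eq_abs]

theorem chNorm_add_le {c d : EReal} {p : ℝ} [hp : Fact (1 < p)] {ν : ℕ} {w : ℝ → ℝ}
    (f g : Ch c d p ν w) :
    chNorm c d p ν w ((f + g : Ch c d p ν w) : ℝ →ₘ[leb c d] ℝ)
      ≤ chNorm c d p ν w (f : ℝ →ₘ[leb c d] ℝ) + chNorm c d p ν w (g : ℝ →ₘ[leb c d] ℝ) := by
  unfold chNorm
  rw [Submodule.coe_add,
    eLpNorm_congr_ae (weighted_add w f.2.1 g.2.1 (AEEqFun.coeFn_add _ _)),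
    ← ENNReal.toReal_add f.2.2.2.ne g.2.2.2.ne]
  refine ENNReal.toReal_mono (ENNReal.add_ne_top.2 ⟨f.2.2.2.ne, g.2.2.2.ne⟩) ?_
  exact eLpNorm_add_le f.2.2.1 g.2.2.1 (ENNReal.one_le_ofReal.2 hp.out.le)

/-- `‖·‖_{Ch_{p,w}(I)}` as a seminorm on `Ch_{p,w}(I)`. -/
def chSeminorm (c d : EReal) (p : ℝ) [Fact (1 < p)] (ν : ℕ) (w : ℝ → ℝ) :
    Seminorm ℝ (Ch c d p ν w) :=
  Seminorm.of (fun f => chNorm c d p ν w (f : ℝ →ₘ[leb c d] ℝ)) chNorm_add_le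
    (fun a f => chNorm_smul a f)

instance instSeminormedCh (c d : EReal) (p : ℝ) [Fact (1 < p)] (ν : ℕ) (w : ℝ → ℝ) :
    SeminormedAddCommGroup (Ch c d p ν w) :=
  (chSeminorm c d p ν w).toAddGroupSeminorm.toSeminormedAddCommGroup

instance instNormedSpaceCh (c d : EReal) (p : ℝ) [Fact (1 < p)] (ν : ℕ) (w : ℝ → ℝ) :
    NormedSpace ℝ (Ch c d p ν w) where
  norm_smul_le a f := (chNorm_smul a f).le

end AlteredCesaro

end

/-! The map `T f = w ∫_{I_{ν,·}} f` preserves the norm from `Ch_{p,w}(I)` to `L^p(I)`. A functional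
`Λ` therefore passes to the range of `T` and extends by Hahn–Banach to `L^p(I)` with the same norm
(`exists_extension_along_norm_preserving`); no description of the range is needed. The Riesz theorem
(`LpDuality.exists_density`) represents the extension by some `g ∈ L^{p'}(I)` of that norm, and `h =
w g` represents `Λ`. For Riesz over a finite measure, Radon–Nikodym gives `g` on indicators, testing
against truncations of `sign g · |g|^(q-1)` bounds its norm, and density of simple functions
concludes. A positive integrable weight carries this to σ-finite measures. -/

namespace LpDuality

/-! ### Riesz representation on `L^p` of a finite measure. -/

open Filter
open scoped ENNReal NNReal Topology

variable {α : Type*} {m : MeasurableSpace α} {μ : Measure α}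

/-- The signed measure `s ↦ F 1_s` of a continuous linear functional on `L^p` of a finite
measure. -/
noncomputable def signedMeasure [IsFiniteMeasure μ] {p : ℝ≥0∞} [Fact (1 ≤ p)] (hp : p ≠ ∞)
    (F : Lp ℝ p μ →L[ℝ] ℝ) : SignedMeasure α := by
  classical
  exact
  { measureOf' := fun s => if hs : MeasurableSet s then
      F (indicatorConstLp p hs (measure_ne_top μ s) 1) else 0
    empty' := by simp
    not_measurable' := fun s hs => dif_neg hs
    m_iUnion' := by
      intro f hf hd
      have hU : MeasurableSet (⋃ i, f i) := MeasurableSet.iUnion hf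
      have hT : ∀ S : Finset ℕ, MeasurableSet (⋃ i ∈ S, f i) :=
        fun S => S.measurableSet_biUnion fun i _ => hf i
      have hsum : ∀ S : Finset ℕ,
          ∑ i ∈ S, indicatorConstLp p (hf i) (measure_ne_top μ (f i)) (1 : ℝ)
            = indicatorConstLp p (hT S) (measure_ne_top μ _) 1 := by
        intro S
        induction S using Finset.induction_on with
        | empty => simp
        | insert a S ha ih =>
          have hdis : Disjoint (f a) (⋃ i ∈ S, f i) := by
            rw [Set.disjoint_iUnion₂_right]
            exact fun i hi => hd (fun h => ha (h ▸ hi))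
          rw [Finset.sum_insert ha, ih,
            ← indicatorConstLp_disjoint_union _ _ _ _ hdis]
          congr 1
          simp
      simp only [hf, hU, dif_pos]
      -- Partial sums are indicators of partial unions. They converge in `L^p` because `p < ∞` and
      -- the measure of the remainder tends to zero.
      refine ContinuousLinearMap.hasSum F ?_
      unfold HasSum
      simp only [hsum, SummationFilter.unconditional_filter]
      refine tendsto_indicatorConstLp_set hp ?_
      have h1 : Tendsto (fun S : Finset ℕ => μ ((⋃ i, f i) \ ⋃ i ∈ S, f i)) atTop (𝓝 0) := by
        have hmono : Monotone fun S : Finset ℕ => ⋃ i ∈ S, f i :=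
          fun S T h => Set.biUnion_subset_biUnion_left h
        have hlim := tendsto_measure_iUnion_atTop (μ := μ) hmono
        have hUU : (⋃ S : Finset ℕ, ⋃ i ∈ S, f i) = ⋃ i, f i :=
          (Set.iUnion_eq_iUnion_finset f).symm
        rw [hUU] at hlim
        have := ENNReal.Tendsto.sub (tendsto_const_nhds (x := μ (⋃ i, f i))) hlim
          (Or.inl (measure_ne_top _ _))
        rw [tsub_self] at this
        refine this.congr fun S => ?_
        rw [measure_sdiff (Set.iUnion₂_subset_iUnion _ _) (hT S).nullMeasurableSet
          (measure_ne_top _ _), Function.comp_apply]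
      refine h1.congr fun S => ?_
      rw [symmDiff_of_le (Set.iUnion₂_subset_iUnion _ _)] }

theorem signedMeasure_apply [IsFiniteMeasure μ] {p : ℝ≥0∞} [Fact (1 ≤ p)] (hp : p ≠ ∞)
    (F : Lp ℝ p μ →L[ℝ] ℝ) {s : Set α} (hs : MeasurableSet s) :
    signedMeasure hp F s = F (indicatorConstLp p hs (measure_ne_top μ s) 1) :=
  dif_pos hs

/-- The Radon–Nikodym density of a continuous linear functional on `L^p` of a finite measure. -/
theorem exists_integrable_density [IsFiniteMeasure μ] {p : ℝ≥0∞} [Fact (1 ≤ p)] (hp : p ≠ ∞)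
    (F : Lp ℝ p μ →L[ℝ] ℝ) :
    ∃ g : α → ℝ, Measurable g ∧ Integrable g μ ∧ ∀ s (hs : MeasurableSet s),
      F (indicatorConstLp p hs (measure_ne_top μ s) 1) = ∫ x in s, g x ∂μ := by
  have hac : (signedMeasure hp F) ≪ᵥ μ.toENNRealVectorMeasure := by
    refine VectorMeasure.AbsolutelyContinuous.mk fun s hs h0 => ?_
    rw [Measure.toENNRealVectorMeasure_apply_measurable hs] at h0
    rw [signedMeasure_apply hp F hs]
    have : indicatorConstLp p hs (measure_ne_top μ s) (1 : ℝ) = 0 := by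
      rw [← indicatorConstLp_empty (μ := μ) (c := (1 : ℝ)), indicatorConstLp_inj _ _ _ _ one_ne_zero]
      exact ae_eq_empty.2 h0
    rw [this, map_zero]
  refine ⟨(signedMeasure hp F).rnDeriv μ, SignedMeasure.measurable_rnDeriv _ _,
    SignedMeasure.integrable_rnDeriv _ _, fun s hs => ?_⟩
  rw [← withDensityᵥ_apply (SignedMeasure.integrable_rnDeriv _ _) hs,
    SignedMeasure.withDensityᵥ_rnDeriv_eq _ _ hac, signedMeasure_apply hp F hs]

/-- A density for indicators is a density for simple functions. -/
theorem apply_simpleFunc [IsFiniteMeasure μ] {p : ℝ≥0∞} [Fact (1 ≤ p)]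
    {F : Lp ℝ p μ →L[ℝ] ℝ} {g : α → ℝ} (hg : Integrable g μ)
    (hF : ∀ s (hs : MeasurableSet s),
      F (indicatorConstLp p hs (measure_ne_top μ s) 1) = ∫ x in s, g x ∂μ) (s : SimpleFunc α ℝ) :
    Integrable (fun x => s x * g x) μ ∧
      F ((s.memLp_of_isFiniteMeasure p μ).toLp s) = ∫ x, s x * g x ∂μ := by
  induction s using SimpleFunc.induction with
  | @const c t ht =>
    have he : (⇑(SimpleFunc.piecewise t ht (SimpleFunc.const α c) (SimpleFunc.const α 0)) : α → ℝ)
        = t.indicator fun _ => c := by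
      ext x; by_cases hx : x ∈ t <;> simp [hx]
    have he2 : (fun x => t.indicator (fun _ => c) x * g x) = t.indicator fun x => c * g x := by
      ext x; by_cases hx : x ∈ t <;> simp [hx]
    have he3 : ((SimpleFunc.memLp_of_isFiniteMeasure (SimpleFunc.piecewise t ht
        (SimpleFunc.const α c) (SimpleFunc.const α 0)) p μ).toLp _ : Lp ℝ p μ)
        = c • indicatorConstLp p ht (measure_ne_top μ t) 1 := by
      rw [indicatorConstLp, ← MemLp.toLp_const_smul, MemLp.toLp_eq_toLp_iff, he]
      refine Eventually.of_forall fun x => ?_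
      by_cases hx : x ∈ t <;> simp [hx]
    rw [he3, map_smul, hF t ht]
    simp only [he, he2]
    refine ⟨(hg.const_mul c).indicator ht, ?_⟩
    rw [integral_indicator ht, integral_const_mul, smul_eq_mul]
  | @add s t _ hs ht =>
    simp only [SimpleFunc.coe_add, Pi.add_apply, add_mul]
    refine ⟨hs.1.add ht.1, ?_⟩
    rw [integral_add hs.1 ht.1, ← hs.2, ← ht.2, ← map_add, ← MemLp.toLp_add]

theorem enorm_apply_toLp_le {p : ℝ≥0∞} [Fact (1 ≤ p)] (F : Lp ℝ p μ →L[ℝ] ℝ) {u : α → ℝ}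
    (hu : MemLp u p μ) : ‖F (hu.toLp u)‖ₑ ≤ ‖F‖ₑ * eLpNorm u p μ := by
  rw [← Lp.enorm_toLp hu]
  exact F.le_opENorm _

/-- From `A ≤ N * A ^ (1 / p)` with `A` finite it follows that `A ≤ N ^ q`. -/
theorem le_rpow_of_le_mul_rpow {p q : ℝ} (hpq : p.HolderConjugate q) {A N : ℝ≥0∞} (hA : A ≠ ∞)
    (h : A ≤ N * A ^ (1 / p)) : A ≤ N ^ q := by
  rcases eq_or_ne A 0 with rfl | h0
  · exact zero_le
  have hq : 0 < q := hpq.symm.pos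
  have h1 : A ^ (1 / p) ≠ 0 := by simp [h0, hA]
  have h2 : A ^ (1 / p) ≠ ∞ := ENNReal.rpow_ne_top_of_nonneg (by have := hpq.pos; positivity) hA
  -- As `1/p + 1/q = 1`, cancelling `A ^ (1 / p)` leaves `A ^ (1 / q) ≤ N`.
  have h3 : A = A ^ (1 / q) * A ^ (1 / p) := by
    rw [← ENNReal.rpow_add _ _ h0 hA, one_div, one_div, hpq.symm.inv_add_inv_eq_one,
      ENNReal.rpow_one]
  have h4 : A ^ (1 / q) ≤ N := by
    rw [h3] at h
    refine (ENNReal.mul_le_mul_iff_left h1 h2).1 ?_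
    rwa [← h3] at h ⊢
  calc A = (A ^ (1 / q)) ^ q := by
        rw [← ENNReal.rpow_mul, one_div_mul_cancel hq.ne', ENNReal.rpow_one]
    _ ≤ N ^ q := ENNReal.rpow_le_rpow h4 hq.le

/-- The `q`-norm of the density is at most the norm of the functional. -/
theorem eLpNorm_density_le [IsFiniteMeasure μ] {p q : ℝ} (hpq : p.HolderConjugate q)
    [Fact (1 ≤ ENNReal.ofReal p)] {F : Lp ℝ (ENNReal.ofReal p) μ →L[ℝ] ℝ} {g : α → ℝ}
    (hgm : Measurable g) (hg : Integrable g μ)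
    (hF : ∀ s (hs : MeasurableSet s),
      F (indicatorConstLp (ENNReal.ofReal p) hs (measure_ne_top μ s) 1) = ∫ x in s, g x ∂μ) :
    eLpNorm g (ENNReal.ofReal q) μ ≤ ‖F‖ₑ := by
  have hp0 := hpq.pos
  have hq0 := hpq.symm.pos
  have hq1 : 0 < q - 1 := by linarith [hpq.symm.lt]
  have hp1 : 0 < p - 1 := by linarith [hpq.lt]
  have hqp : (q - 1) * p = q := by
    have := hpq.mul_eq_add; linarith
  have hqp1 : (q - 1) * (p - 1) = 1 := by
    have := hpq.mul_eq_add; linarith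
  -- The extremal case of Hölder: `k ^ p = |g| ^ q = k * |g|`. Simple functions `t n` increasing to
  -- `k` replace it, since `∫ k ^ p` is not yet known to be finite.
  set k : α → ℝ≥0∞ := fun x => ‖g x‖ₑ ^ (q - 1) with hk
  have hkm : Measurable k := hgm.enorm.pow_const _
  set t : ℕ → SimpleFunc α ℝ≥0∞ := SimpleFunc.eapprox k
  have htk : ∀ n x, t n x ≤ k x := fun n x => by
    rw [← SimpleFunc.iSup_eapprox_apply hkm x]; exact le_iSup (fun n => t n x) n
  have hbound : ∀ n, ∫⁻ x, t n x ^ p ∂μ ≤ ‖F‖ₑ ^ q := by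
    intro n
    -- A sign of `g` equal to `1` where `g = 0`, so that `|σ| = 1` everywhere.
    set σ : SimpleFunc α ℝ := SimpleFunc.piecewise {x | 0 ≤ g x} (measurableSet_le measurable_const hgm)
      (SimpleFunc.const α 1) (SimpleFunc.const α (-1)) with hσ
    have hσg : ∀ x, σ x * g x = |g x| := by
      intro x
      by_cases hx : 0 ≤ g x
      · simp [hσ, SimpleFunc.piecewise_apply, hx, abs_of_nonneg]
      · simp [hσ, SimpleFunc.piecewise_apply, hx, abs_of_neg (not_le.1 hx)]
    have hσ1 : ∀ x, ‖σ x‖ₑ = 1 := by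
      intro x
      by_cases hx : 0 ≤ g x <;> simp [hσ, SimpleFunc.piecewise_apply, hx]
    set s : SimpleFunc α ℝ := (t n).map ENNReal.toReal * σ with hs
    have hsx : ∀ x, s x = (t n x).toReal * σ x := fun x => rfl
    have htop : ∀ x, t n x ≠ ∞ := fun x => (SimpleFunc.eapprox_lt_top k n x).ne
    have hse : ∀ x, ‖s x‖ₑ = t n x := by
      intro x
      rw [hsx, enorm_mul, hσ1, mul_one, Real.enorm_of_nonneg ENNReal.toReal_nonneg,
        ENNReal.ofReal_toReal (htop x)]
    have hnorm : eLpNorm s (ENNReal.ofReal p) μ = (∫⁻ x, t n x ^ p ∂μ) ^ (1 / p) := by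
      rw [eLpNorm_eq_lintegral_rpow_enorm_toReal (by simpa using hp0) ENNReal.ofReal_ne_top,
        ENNReal.toReal_ofReal hp0.le]
      simp only [hse]
    have hfin : ∫⁻ x, t n x ^ p ∂μ ≠ ∞ := by
      have := (s.memLp_of_isFiniteMeasure (ENNReal.ofReal p) μ).2
      rw [hnorm] at this
      intro h
      rw [h, ENNReal.top_rpow_of_pos (by positivity)] at this
      exact lt_irrefl _ this
    refine le_rpow_of_le_mul_rpow hpq hfin ?_
    obtain ⟨hi, hFs⟩ := apply_simpleFunc hg hF s
    have hsg : ∀ x, s x * g x = (t n x).toReal * |g x| := by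
      intro x; rw [hsx, mul_assoc, hσg]
    calc ∫⁻ x, t n x ^ p ∂μ ≤ ∫⁻ x, ‖s x * g x‖ₑ ∂μ := by
          refine lintegral_mono fun x => ?_
          -- `k ^ (p - 1) = |g|` because `(q - 1) * (p - 1) = 1`.
          have h1 : t n x ^ (p - 1) ≤ ‖g x‖ₑ := by
            calc t n x ^ (p - 1) ≤ k x ^ (p - 1) := ENNReal.rpow_le_rpow (htk n x) hp1.le
              _ = ‖g x‖ₑ := by rw [hk, ← ENNReal.rpow_mul, hqp1, ENNReal.rpow_one]
          rw [enorm_mul, hse]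
          calc t n x ^ p = t n x * t n x ^ (p - 1) := by
                nth_rw 2 [← ENNReal.rpow_one (t n x)]
                rw [← ENNReal.rpow_add_of_nonneg _ _ zero_le_one hp1.le]
                congr 1; ring
            _ ≤ _ := by gcongr
      _ = ‖∫ x, s x * g x ∂μ‖ₑ := by
          have hnn : ∀ x, 0 ≤ s x * g x := fun x => by rw [hsg]; positivity
          rw [Real.enorm_of_nonneg (integral_nonneg hnn),
            ofReal_integral_eq_lintegral_ofReal hi (Eventually.of_forall hnn)]
          exact lintegral_congr fun x => Real.enorm_of_nonneg (hnn x)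
      _ ≤ ‖F‖ₑ * (∫⁻ x, t n x ^ p ∂μ) ^ (1 / p) := by
          rw [← hFs, ← hnorm]
          exact enorm_apply_toLp_le F _
  have hmct : ∫⁻ x, ‖g x‖ₑ ^ q ∂μ = ⨆ n, ∫⁻ x, t n x ^ p ∂μ := by
    rw [← lintegral_iSup (fun n => (t n).measurable.pow_const _)
      (fun i j hij x => ENNReal.rpow_le_rpow (SimpleFunc.monotone_eapprox k hij x) hp0.le)]
    refine lintegral_congr fun x => ?_
    have h1 : (⨆ n, t n x) ^ p = ⨆ n, t n x ^ p :=
      (ENNReal.orderIsoRpow p hp0).map_iSup fun n => t n x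
    rw [← h1, SimpleFunc.iSup_eapprox_apply hkm, hk, ← ENNReal.rpow_mul, hqp]
  rw [eLpNorm_eq_lintegral_rpow_enorm_toReal (by simpa using hq0) ENNReal.ofReal_ne_top,
    ENNReal.toReal_ofReal hq0.le, hmct, one_div, ENNReal.rpow_inv_le_iff hq0]
  exact iSup_le hbound

/-- Hölder: a product of functions in dual spaces is integrable, and its integral is bounded. -/
theorem integrable_mul_and_enorm_integral_le {p q : ℝ≥0∞} (hpq : p.HolderConjugate q)
    {g u : α → ℝ} (hg : MemLp g q μ) (hu : MemLp u p μ) :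
    Integrable (fun x => g x * u x) μ ∧
      ‖∫ x, g x * u x ∂μ‖ₑ ≤ eLpNorm g q μ * eLpNorm u p μ := by
  have h1 : MemLp (fun x => g x * u x) 1 μ := hu.mul' hg
  have h2 : eLpNorm (fun x => g x * u x) 1 μ ≤ eLpNorm g q μ * eLpNorm u p μ := by
    have := eLpNorm_smul_le_mul_eLpNorm (p := q) (q := p) (r := 1) hu.1 hg.1
    exact this
  refine ⟨memLp_one_iff_integrable.1 h1, (enorm_integral_le_lintegral_enorm _).trans ?_⟩
  rwa [← eLpNorm_one_eq_lintegral_enorm]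

/-- A functional with a density has norm at most the `q`-norm of the density. -/
theorem enorm_le_of_forall_eq_integral {p q : ℝ} (hpq : p.HolderConjugate q)
    [Fact (1 ≤ ENNReal.ofReal p)] {F : Lp ℝ (ENNReal.ofReal p) μ →L[ℝ] ℝ} {g : α → ℝ}
    (hg : MemLp g (ENNReal.ofReal q) μ) (hF : ∀ u, F u = ∫ x, g x * u x ∂μ) :
    ‖F‖ₑ ≤ eLpNorm g (ENNReal.ofReal q) μ := by
  refine ContinuousLinearMap.opENorm_le_bound (f := F) fun u => ?_
  rw [hF u, Lp.enorm_def]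
  exact (integrable_mul_and_enorm_integral_le hpq.ennrealOfReal hg (Lp.memLp u)).2

/-- Riesz representation for `L^p` of a finite measure. -/
theorem exists_density_of_isFiniteMeasure [IsFiniteMeasure μ] {p q : ℝ}
    (hpq : p.HolderConjugate q) [Fact (1 ≤ ENNReal.ofReal p)]
    (F : Lp ℝ (ENNReal.ofReal p) μ →L[ℝ] ℝ) :
    ∃ g : α → ℝ, MemLp g (ENNReal.ofReal q) μ ∧ eLpNorm g (ENNReal.ofReal q) μ ≤ ‖F‖ₑ ∧
      ∀ u, F u = ∫ x, g x * u x ∂μ := by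
  obtain ⟨g, hgm, hgi, hgF⟩ := exists_integrable_density ENNReal.ofReal_ne_top F
  have hg : MemLp g (ENNReal.ofReal q) μ :=
    ⟨hgm.aestronglyMeasurable, (eLpNorm_density_le hpq hgm hgi hgF).trans_lt enorm_lt_top⟩
  refine ⟨g, hg, eLpNorm_density_le hpq hgm hgi hgF, ?_⟩
  have := hpq.symm.ennrealOfReal
  have : Fact (1 ≤ ENNReal.ofReal q) := ⟨ENNReal.one_le_ofReal.2 hpq.symm.lt.le⟩
  -- With the pairing against `g` continuous, `F = G` need only be checked on indicators.
  set G : Lp ℝ (ENNReal.ofReal p) μ →L[ℝ] ℝ :=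
    (ContinuousLinearMap.mul ℝ ℝ).lpPairing μ (ENNReal.ofReal q) (ENNReal.ofReal p) (hg.toLp g)
  have hG : ∀ u, G u = ∫ x, g x * u x ∂μ := by
    intro u
    rw [ContinuousLinearMap.lpPairing_eq_integral]
    refine integral_congr_ae ?_
    filter_upwards [hg.coeFn_toLp] with x hx
    simp [hx]
  have hFG : ∀ u, F u = G u := by
    refine Lp.induction ENNReal.ofReal_ne_top _ ?_ ?_ (isClosed_eq F.continuous G.continuous)
    · intro c s hs hμs
      have h1 : ((Lp.simpleFunc.indicatorConst (ENNReal.ofReal p) hs hμs.ne c :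
          Lp.simpleFunc ℝ (ENNReal.ofReal p) μ) : Lp ℝ (ENNReal.ofReal p) μ)
          = c • indicatorConstLp (ENNReal.ofReal p) hs hμs.ne 1 := by
        rw [Lp.simpleFunc.coe_indicatorConst, indicatorConstLp, indicatorConstLp,
          ← MemLp.toLp_const_smul, MemLp.toLp_eq_toLp_iff]
        refine Eventually.of_forall fun x => ?_
        by_cases hx : x ∈ s <;> simp [hx]
      rw [h1, map_smul, map_smul, hgF s hs, hG, ← integral_indicator hs]
      congr 1
      refine integral_congr_ae ?_
      filter_upwards [indicatorConstLp_coeFn (p := ENNReal.ofReal p) (hs := hs) (hμs := hμs.ne)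
        (c := (1 : ℝ))] with x hx
      rw [hx]
      by_cases hxs : x ∈ s <;> simp [hxs]
    · intro f g hf hg _ h1 h2
      rw [map_add, map_add, h1, h2]
  intro u
  rw [hFG, hG]

/-! ### Passage to σ-finite measures by a change of density. -/

theorem eLpNorm_withDensity {r : ℝ} (hr : 0 < r) {w : α → ℝ≥0} (hw : Measurable w) (f : α → ℝ) :
    eLpNorm f (ENNReal.ofReal r) (μ.withDensity fun x => w x)
      = eLpNorm (fun x => (w x : ℝ) ^ r⁻¹ * f x) (ENNReal.ofReal r) μ := by
  rw [eLpNorm_eq_lintegral_rpow_enorm_toReal (by simpa using hr) ENNReal.ofReal_ne_top,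
    eLpNorm_eq_lintegral_rpow_enorm_toReal (by simpa using hr) ENNReal.ofReal_ne_top,
    ENNReal.toReal_ofReal hr.le,
    lintegral_withDensity_eq_lintegral_mul_non_measurable _ hw.coe_nnreal_ennreal
      (Eventually.of_forall fun x => ENNReal.coe_lt_top)]
  congr 1
  refine lintegral_congr fun x => ?_
  have h1 : ‖(w x : ℝ) ^ r⁻¹‖ₑ = (w x : ℝ≥0∞) ^ r⁻¹ := by
    rw [Real.enorm_of_nonneg (by positivity), ← ENNReal.ofReal_rpow_of_nonneg (by positivity)
      (by positivity), ENNReal.ofReal_coe_nnreal]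
  rw [enorm_mul, ENNReal.mul_rpow_of_nonneg _ _ hr.le, h1, ENNReal.rpow_inv_rpow hr.ne']
  rfl

/-- Positivity of `w` makes the two measures mutually absolutely continuous, so measurability
transfers both ways. -/
theorem memLp_withDensity_iff {r : ℝ} (hr : 0 < r) {w : α → ℝ≥0} (hw : Measurable w)
    (hpos : ∀ x, 0 < w x) (f : α → ℝ) :
    MemLp f (ENNReal.ofReal r) (μ.withDensity fun x => w x)
      ↔ MemLp (fun x => (w x : ℝ) ^ r⁻¹ * f x) (ENNReal.ofReal r) μ := by
  have hwr : Measurable fun x => (w x : ℝ) ^ r⁻¹ := hw.coe_nnreal_real.pow_const _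
  have hwr' : Measurable fun x => ((w x : ℝ) ^ r⁻¹)⁻¹ := hwr.inv
  have hac : μ ≪ μ.withDensity fun x => (w x : ℝ≥0∞) :=
    withDensity_absolutelyContinuous' hw.coe_nnreal_ennreal.aemeasurable
      (Eventually.of_forall fun x => by simpa using (hpos x).ne')
  unfold MemLp
  rw [eLpNorm_withDensity hr hw]
  refine and_congr_left fun _ =>
    ⟨fun h => hwr.aestronglyMeasurable.mul (h.mono_ac hac), fun h => ?_⟩
  refine ((hwr'.aestronglyMeasurable.mul h).congr (Eventually.of_forall fun x => ?_)).mono_ac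
    (withDensity_absolutelyContinuous _ _)
  have : 0 < (w x : ℝ) ^ r⁻¹ := Real.rpow_pos_of_pos (hpos x) _
  simp [inv_mul_cancel_left₀ this.ne']

/-- Riesz representation for `L^p` of a `σ`-finite measure, `1 < p < ∞`. -/
theorem exists_density [SigmaFinite μ] {p q : ℝ} (hpq : p.HolderConjugate q)
    [Fact (1 ≤ ENNReal.ofReal p)] (F : Lp ℝ (ENNReal.ofReal p) μ →L[ℝ] ℝ) :
    ∃ g : α → ℝ, MemLp g (ENNReal.ofReal q) μ ∧ eLpNorm g (ENNReal.ofReal q) μ = ‖F‖ₑ ∧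
      ∀ u, F u = ∫ x, g x * u x ∂μ := by
  have hp := hpq.pos
  have hq := hpq.symm.pos
  obtain ⟨w, hpos, hw, hwi⟩ := exists_pos_lintegral_lt_of_sigmaFinite μ one_ne_zero
  set μ' := μ.withDensity fun x => (w x : ℝ≥0∞) with hμ'
  have : IsFiniteMeasure μ' := isFiniteMeasure_withDensity (hwi.trans ENNReal.one_lt_top).ne
  have hac : μ ≪ μ' :=
    withDensity_absolutelyContinuous' hw.coe_nnreal_ennreal.aemeasurable
      (Eventually.of_forall fun x => by simpa using (hpos x).ne')
  have hJ : ∀ h : Lp ℝ (ENNReal.ofReal p) μ',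
      MemLp (fun x => (w x : ℝ) ^ p⁻¹ * h x) (ENNReal.ofReal p) μ :=
    fun h => (memLp_withDensity_iff hp hw hpos _).1 (Lp.memLp h)
  -- Multiplication by `w ^ (1/p)`, an isometry; `hJu` below exhibits the preimage of each `u`.
  let J₀ : Lp ℝ (ENNReal.ofReal p) μ' →ₗ[ℝ] Lp ℝ (ENNReal.ofReal p) μ :=
    { toFun := fun h => (hJ h).toLp _
      map_add' := fun h k => by
        rw [← MemLp.toLp_add, MemLp.toLp_eq_toLp_iff]
        filter_upwards [hac.ae_le (Lp.coeFn_add h k)] with x hx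
        simp only [hx, Pi.add_apply, mul_add]
      map_smul' := fun a h => by
        rw [← MemLp.toLp_const_smul, MemLp.toLp_eq_toLp_iff]
        filter_upwards [hac.ae_le (Lp.coeFn_smul a h)] with x hx
        simp only [hx, Pi.smul_apply, smul_eq_mul, RingHom.id_apply, mul_left_comm] }
  have hJ₀ : ∀ h, ‖J₀ h‖ ≤ 1 * ‖h‖ := fun h => by
    have h1 := eLpNorm_withDensity (μ := μ) hp hw h
    rw [one_mul, Lp.norm_def h, h1]
    exact (Lp.norm_toLp _ (hJ h)).le
  obtain ⟨g, hg, hgF, hgi⟩ := exists_density_of_isFiniteMeasure hpq (F.comp (J₀.mkContinuous 1 hJ₀))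
  have hgm : MemLp (fun x => (w x : ℝ) ^ q⁻¹ * g x) (ENNReal.ofReal q) μ :=
    (memLp_withDensity_iff hq hw hpos _).1 hg
  have hrep : ∀ u, F u = ∫ x, ((w x : ℝ) ^ q⁻¹ * g x) * u x ∂μ := by
    intro u
    have hcancel : ∀ x, (w x : ℝ) ^ p⁻¹ * (((w x : ℝ) ^ p⁻¹)⁻¹ * u x) = u x := fun x =>
      mul_inv_cancel_left₀ (Real.rpow_pos_of_pos (hpos x) _).ne' _
    have hu : MemLp (fun x => ((w x : ℝ) ^ p⁻¹)⁻¹ * u x) (ENNReal.ofReal p) μ' := by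
      rw [hμ', memLp_withDensity_iff hp hw hpos]
      simpa only [hcancel] using Lp.memLp u
    have hJu : J₀ (hu.toLp _) = u := by
      refine Lp.ext ?_
      filter_upwards [(hJ (hu.toLp _)).coeFn_toLp, hac.ae_le hu.coeFn_toLp] with x h1 h2
      change ((hJ (hu.toLp _)).toLp _ : α → ℝ) x = u x
      rw [h1, h2, hcancel]
    calc F u = ∫ x, g x * (hu.toLp _) x ∂μ' := by
          rw [← hgi]; simp [hJu]
      _ = ∫ x, g x * (((w x : ℝ) ^ p⁻¹)⁻¹ * u x) ∂μ' := by
          refine integral_congr_ae ?_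
          filter_upwards [hu.coeFn_toLp] with x hx
          rw [hx]
      _ = _ := by
          rw [hμ', integral_withDensity_eq_integral_smul hw]
          congr 1
          ext x
          have hx : (0 : ℝ) < w x := hpos x
          -- The factor `w ^ (1/p)` cancels the one in the preimage of `u`; `w ^ (1/q)` stays with
          -- `g`.
          have h1 : (w x : ℝ) = (w x : ℝ) ^ p⁻¹ * (w x : ℝ) ^ q⁻¹ := by
            rw [← Real.rpow_add hx, hpq.inv_add_inv_eq_one, Real.rpow_one]
          have h2 : (w x : ℝ) ^ p⁻¹ ≠ 0 := (Real.rpow_pos_of_pos hx _).ne'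
          rw [NNReal.smul_def, smul_eq_mul]
          nth_rw 1 [h1]
          field_simp
  refine ⟨_, hgm, le_antisymm ?_ (enorm_le_of_forall_eq_integral hpq hgm hrep), hrep⟩
  rw [← eLpNorm_withDensity hq hw]
  refine hgF.trans (enorm_le_iff_norm_le.2 ?_)
  calc _ ≤ ‖F‖ * ‖J₀.mkContinuous 1 hJ₀‖ := F.opNorm_comp_le _
    _ ≤ ‖F‖ * 1 := by gcongr; exact J₀.mkContinuous_norm_le zero_le_one _
    _ = ‖F‖ := mul_one _

end LpDuality

/-! ### Extension of functionals from a seminormed space. -/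

/-- Hahn–Banach along a norm-preserving linear map: a functional on the source extends to the
target with the same norm. -/
theorem exists_extension_along_norm_preserving {E V : Type*} [SeminormedAddCommGroup E]
    [NormedSpace ℝ E] [SeminormedAddCommGroup V] [NormedSpace ℝ V] (T : E →ₗ[ℝ] V)
    (hT : ∀ f, ‖T f‖ = ‖f‖) (Λ : E →L[ℝ] ℝ) :
    ∃ F : V →L[ℝ] ℝ, (∀ f, F (T f) = Λ f) ∧ ‖F‖ = ‖Λ‖ := by
  -- Only seminorms are given, so `T` need not be injective; `S` is an arbitrary linear choice of
  -- preimages.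
  obtain ⟨S, hS⟩ := T.rangeRestrict.exists_rightInverse_of_surjective T.range_rangeRestrict
  have hTS : ∀ y : LinearMap.range T, T (S y) = y := fun y =>
    congrArg Subtype.val (LinearMap.congr_fun hS y)
  have hbound : ∀ y, ‖(Λ.toLinearMap ∘ₗ S) y‖ ≤ ‖Λ‖ * ‖y‖ := fun y => by
    calc ‖Λ (S y)‖ ≤ ‖Λ‖ * ‖S y‖ := Λ.le_opNorm _
      _ = ‖Λ‖ * ‖y‖ := by rw [← hT, hTS]; rfl
  obtain ⟨F, hF, hn⟩ := exists_extension_norm_eq (LinearMap.range T)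
    ((Λ.toLinearMap ∘ₗ S).mkContinuous ‖Λ‖ hbound)
  have hFT : ∀ f, F (T f) = Λ f := fun f => by
    have h1 : F (T f) = Λ (S (T.rangeRestrict f)) := hF (T.rangeRestrict f)
    -- Two preimages differ by a vector of seminorm zero, on which `Λ` vanishes by continuity.
    have h2 : ‖S (T.rangeRestrict f) - f‖ = 0 := by
      rw [← hT, map_sub, hTS]; simp
    have h3 : Λ (S (T.rangeRestrict f) - f) = 0 := by
      have := Λ.le_opNorm (S (T.rangeRestrict f) - f)
      rw [h2, mul_zero] at this
      exact norm_le_zero_iff.1 this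
    rw [h1, ← sub_eq_zero, ← map_sub, h3]
  refine ⟨F, hFT, le_antisymm ?_ ?_⟩
  · rw [hn]
    exact LinearMap.mkContinuous_norm_le _ (norm_nonneg _) _
  · refine Λ.opNorm_le_bound (norm_nonneg _) fun f => ?_
    rw [← hFT, ← hT]
    exact F.le_opNorm _

/-! ### The embedding into `L^p(I)` and the representation of `Λ`. -/

namespace AlteredCesaro

/-- The norm-preserving map `f ↦ w ∫_{I_{ν,·}} f` from `Ch_{p,w}(I)` to `L^p(I)`. -/
noncomputable def toLp (c d : EReal) (p : ℝ) (ν : ℕ) (w : ℝ → ℝ) :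
    Ch c d p ν w →ₗ[ℝ] Lp ℝ (ENNReal.ofReal p) (leb c d) where
  toFun f := MemLp.toLp _ f.2.2
  map_add' f g := by
    rw [← MemLp.toLp_add, MemLp.toLp_eq_toLp_iff]
    exact weighted_add w f.2.1 g.2.1 (AEEqFun.coeFn_add _ _)
  map_smul' a f := by
    rw [RingHom.id_apply, ← MemLp.toLp_const_smul, MemLp.toLp_eq_toLp_iff]
    exact (weighted_smul w a (AEEqFun.coeFn_smul a _)).eventuallyEq

theorem norm_toLp (c d : EReal) (p : ℝ) [Fact (1 < p)] (ν : ℕ) (w : ℝ → ℝ) (f : Ch c d p ν w) :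
    ‖toLp c d p ν w f‖ = ‖f‖ :=
  Lp.norm_toLp _ f.2.2

theorem toLp_coeFn {c d : EReal} {p : ℝ} {ν : ℕ} {w : ℝ → ℝ} (f : Ch c d p ν w) :
    toLp c d p ν w f =ᵐ[leb c d]
      fun x => w x * primitive c d ν (f : ℝ →ₘ[leb c d] ℝ) x :=
  MemLp.coeFn_toLp f.2.2

end AlteredCesaro

theorem mainTheorem3 (c d : EReal) (hcd : c < d) (p : ℝ) [Fact (1 < p)] (ν : ℕ)
    (hν : ν = 1 ∨ ν = 2) (w : ℝ → ℝ)
    (hw_meas : AEStronglyMeasurable w (AlteredCesaro.leb c d))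
    (hw_pos : ∀ᵐ x ∂(AlteredCesaro.leb c d), 0 < w x)
    (hw_loc : AlteredCesaro.MemLocTwo c d ν (fun x => w x ^ p))
    (Λ : AlteredCesaro.Ch c d p ν w →L[ℝ] ℝ) :
    ∃ h : ℝ → ℝ,
      AlteredCesaro.MemWeightedLp c d (p / (p - 1)) (fun x => 1 / w x) h ∧
      (∀ f : AlteredCesaro.Ch c d p ν w,
        Integrable (fun x => h x *
          AlteredCesaro.primitive c d ν (f : ℝ →ₘ[AlteredCesaro.leb c d] ℝ) x)
          (AlteredCesaro.leb c d) ∧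
        Λ f = ∫ x, h x *
          AlteredCesaro.primitive c d ν (f : ℝ →ₘ[AlteredCesaro.leb c d] ℝ) x
          ∂(AlteredCesaro.leb c d)) ∧
      ‖Λ‖ = AlteredCesaro.weightedLpNorm c d (p / (p - 1)) (fun x => 1 / w x) h := by
  open AlteredCesaro in
  have hp : 1 < p := Fact.out
  have hpq : p.HolderConjugate (p / (p - 1)) := Real.HolderConjugate.conjExponent hp
  have : Fact (1 ≤ ENNReal.ofReal p) := ⟨ENNReal.one_le_ofReal.2 hp.le⟩
  have : SigmaFinite (leb c d) := by unfold leb; infer_instance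
  obtain ⟨F, hF, hFn⟩ := exists_extension_along_norm_preserving (toLp c d p ν w)
    (norm_toLp c d p ν w) Λ
  obtain ⟨g, hg, hgn, hgF⟩ := LpDuality.exists_density hpq F
  have hgw : (fun x => 1 / w x * (w x * g x)) =ᵐ[leb c d] g := by
    filter_upwards [hw_pos] with x hx
    field_simp
  have hmul : ∀ f : Ch c d p ν w, (fun x => g x * toLp c d p ν w f x) =ᵐ[leb c d]
      fun x => w x * g x * primitive c d ν (f : ℝ →ₘ[leb c d] ℝ) x := fun f => by
    filter_upwards [toLp_coeFn f] with x hx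
    rw [hx]; ring
  -- The factor `w` of `T f` is moved onto `g`; dividing by `w > 0` recovers `g`, hence the norm.
  refine ⟨fun x => w x * g x, ⟨hw_meas.mul hg.1, (memLp_congr_ae hgw).2 hg⟩, fun f => ⟨?_, ?_⟩, ?_⟩
  · exact (LpDuality.integrable_mul_and_enorm_integral_le hpq.ennrealOfReal hg (Lp.memLp _)).1.congr (hmul f)
  · rw [← hF, hgF]
    exact integral_congr_ae (hmul f)
  · rw [weightedLpNorm, eLpNorm_congr_ae hgw, hgn, hFn.symm, toReal_enorm]
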